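/- Let $N\ge 0$ and let $P$ be a convex $(N+2)$-gon (for $N=0$, a single edge). Color the vertices of $P$, read counterclockwise starting with the left endpoint of the top edge, cyclically $1,2,3,1,2,3,\dots$, except that if $N+2\equiv 1\pmod 3$ then the last vertex in this reading (the right endpoint of the top edge) is colored $2$ instead of $1$. A triangulation of $P$ is the plane graph obtained by drawing straight segments between vertices of $P$, no two meeting in the interior of $P$, so that all bounded regions are triangles; it is proper if the vertices of every triangle carry all three colors. (A single edge is considered as a proper triangulation of itself.) Let $b_N$ be the number of proper triangulations of $P$. Then for every $n\ge 0$ $$ b_{3n}=\frac{1}{3n+1}\binom{4n}{n},\qquad b_{3n+1}=\frac{2}{3n+2}\binom{4n+1}{n},\qquad b_{3n+2}=\frac{3}{3n+3}\binom{4n+2}{n}. $$ -/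

import Mathlib

/-! Partitions of a convex polygon. The vertices of a convex `m`-gon are `0, 1, …, m - 1 : Fin m`,
listed in counterclockwise order, so that the root (top) edge joins `0` and `m - 1`. A set of
straight segments between vertices, together with the sides, is a graph on `Fin m`. -/

namespace ConvexPolygon

/-- A partition of the convex `m`-gon: a graph on its vertices that contains all the sides and is
drawn in a plane fashion. Two chords of a convex polygon meet in its interior
if and only if their four endpoints are distinct and alternate around the polygon. -/
def IsPartition {m : ℕ} (G : SimpleGraph (Fin m)) : Prop :=
  SimpleGraph.cycleGraph m ≤ G ∧
    ∀ a b c d : Fin m, a < b → b < c → c < d → ¬(G.Adj a c ∧ G.Adj b d)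

/-- `a < b` are neighbours on the boundary of the convex polygon spanned by the vertex set `S`: on
one of the two sides of the chord `ab` there is no vertex of `S`. -/
def Consecutive {m : ℕ} (S : Finset (Fin m)) (a b : Fin m) : Prop :=
  (∀ v ∈ S, ¬(a < v ∧ v < b)) ∨ (∀ v ∈ S, a ≤ v ∧ v ≤ b)

/-- `S` is the vertex set of a bounded region of the partition `G`: the sides of the convex polygon
spanned by `S` are edges of `G`, and no diagonal of that polygon is. (Every vertex of `G` lies on
the boundary of the big polygon and the edges do not cross, so only such a diagonal can
enter the interior of the polygon spanned by `S`.) -/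
def IsRegion {m : ℕ} (G : SimpleGraph (Fin m)) (S : Finset (Fin m)) : Prop :=
  3 ≤ S.card ∧ ∀ a ∈ S, ∀ b ∈ S, a < b → (G.Adj a b ↔ Consecutive S a b)

/-- A `k`-partition: a partition all of whose bounded regions are `k`-gons. -/
def IsKPartition {m : ℕ} (k : ℕ) (G : SimpleGraph (Fin m)) : Prop :=
  IsPartition G ∧ ∀ S, IsRegion G S → S.card = k

/-- A triangulation is a `3`-partition. For `m = 2` the polygon is a single edge, which is its own
only triangulation (it has no regions). -/
def IsTriangulation {m : ℕ} (G : SimpleGraph (Fin m)) : Prop :=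
  IsKPartition 3 G

/-- `G` is proper for the vertex colouring `col` with colours `1, …, c`: every region has all of
the `c` colours among its vertices. -/
def IsProper {m : ℕ} (c : ℕ) (col : Fin m → ℕ) (G : SimpleGraph (Fin m)) : Prop :=
  ∀ S, IsRegion G S → ∀ j, 1 ≤ j → j ≤ c → ∃ v ∈ S, col v = j

/-- The colouring `1, 2, 3, 1, 2, 3, …` of the vertices of an `m`-gon, where the last vertex is
coloured `2` if `m` is congruent to `1` modulo `3`. -/
def color3 (m : ℕ) (v : Fin m) : ℕ :=
  if m % 3 = 1 ∧ (v : ℕ) + 1 = m then 2 else (v : ℕ) % 3 + 1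

/-- The number `b_N` of proper triangulations of the three-coloured `(N + 2)`-gon. -/
noncomputable def b (N : ℕ) : ℕ :=
  Set.ncard {G : SimpleGraph (Fin (N + 2)) |
    IsTriangulation G ∧ IsProper 3 (color3 (N + 2)) G}

end ConvexPolygon

/-!
A triangulation of the polygon with vertices `i, …, j` is determined by the apex `k` of the triangle
at the root edge `ij` and by triangulations of the two polygons `i, …, k` and `k, …, j`. Hence the
numbers of proper triangulations satisfy
`rainbowCount i j = ∑ rainbowCount i k * rainbowCount k j`, summed over those `k` whose colour
completes the colours of `i` and `j` (`rainbowCount_eq_sum`). As the colours are periodic, the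
residue of `k` modulo `3` is determined. Let `A`, `B`, `D` be the generating functions of `b (3 n)`,
`b (3 n + 1)`, `b (3 n + 2)`. The recursion gives `A = 1 + x * B ^ 2` and `B = A ^ 2`, so that
`A = 1 + x * A ^ 4`. In the last case the exceptional colour of the last vertex brings in one more
series `C`, with `D = B * C` and `C = 1 + x * A * D`; this has the solution `C = A`, `D = A ^ 3`
(`rainbowCount_periodic` and `rainbowCount_periodic_shifted_last`).

The coefficients of `A ^ r` can be computed without Lagrange inversion: they are determined by
`A ^ (r + 1) = A ^ r + x * A ^ (r + 4)`, and this recursion yields both the product rule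
(`sum_antidiagonal_quaternaryForests`) and the closed form (`quaternaryForests_mul`).

The definition of a triangulation as a graph all of whose regions are triangles is tied to the
recursion by two facts. A shortest path with at least two steps below an edge spans a region, so in a
triangulation each diagonal has a triangle below it (`IsTriangulation.exists_apex`). Conversely, if
each diagonal has such a triangle, the noncrossing condition forces every region to be the triangle
below its longest edge (`IsRegion.eq_triangle`).
-/

namespace ConvexPolygon

/-! ### The numbers `r / (4 n + r) * (4 n + r).choose n` -/

/-- The number of ordered forests of `r` plane quaternary trees with `n` inner nodes in total,
i.e. the coefficient of `x ^ n` in `A ^ r`, where `A = 1 + x * A ^ 4`. The recursion is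
`A ^ (r + 1) = A ^ r + x * A ^ (r + 4)`, read off at `x ^ (n + 1)`. -/
def quaternaryForests : ℕ → ℕ → ℕ
  | 0, _ => 1
  | _ + 1, 0 => 0
  | n + 1, r + 1 => quaternaryForests (n + 1) r + quaternaryForests n (r + 4)

lemma quaternaryForests_zero (r : ℕ) : quaternaryForests 0 r = 1 := by
  simp [quaternaryForests]

lemma quaternaryForests_succ_zero (n : ℕ) : quaternaryForests (n + 1) 0 = 0 := by
  simp [quaternaryForests]

lemma quaternaryForests_succ_succ (n r : ℕ) : quaternaryForests (n + 1) (r + 1) =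
    quaternaryForests (n + 1) r + quaternaryForests n (r + 4) := by
  rw [quaternaryForests]

/-- The identity `A ^ r * A ^ s = A ^ (r + s)` for coefficients. -/
lemma sum_antidiagonal_quaternaryForests (n r s : ℕ) :
    ∑ p ∈ Finset.HasAntidiagonal.antidiagonal n, quaternaryForests p.1 r * quaternaryForests p.2 s =
      quaternaryForests n (r + s) := by
  induction n generalizing r s with
  | zero => simp [quaternaryForests_zero]
  | succ n ihn =>
    induction r with
    | zero =>
      rw [Finset.Nat.sum_antidiagonal_succ]
      simp [quaternaryForests_zero, quaternaryForests_succ_zero]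
    | succ r ihr =>
      rw [Finset.Nat.sum_antidiagonal_succ] at ihr ⊢
      simp only [quaternaryForests_succ_succ, add_mul, Finset.sum_add_distrib, ihn,
        quaternaryForests_zero] at ihr ⊢
      rw [show r + 1 + s = r + s + 1 by ring, quaternaryForests_succ_succ, ← ihr,
        show r + 4 + s = r + s + 4 by ring]
      ring

lemma quaternaryForests_mul (n r : ℕ) :
    (4 * n + r) * quaternaryForests n r = r * (4 * n + r).choose n := by
  induction n generalizing r with
  | zero => simp [quaternaryForests_zero]
  | succ n ihn =>
    induction r with
    | zero => simp [quaternaryForests_succ_zero]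
    | succ r ihr =>
      have h1 := ihn (r + 4)
      have h2 := Nat.choose_succ_right_eq (4 * n + 4 + r) n
      rw [show 4 * n + 4 + r - n = 3 * n + 4 + r by omega] at h2
      rw [quaternaryForests_succ_succ, show 4 * (n + 1) + (r + 1) = 4 * n + 4 + r + 1 by ring,
        Nat.choose_succ_succ']
      rw [show 4 * (n + 1) + r = 4 * n + 4 + r by ring] at ihr
      rw [show 4 * n + (r + 4) = 4 * n + 4 + r by ring] at h1
      generalize (4 * n + 4 + r).choose n = c at *
      generalize (4 * n + 4 + r).choose (n + 1) = c' at *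
      have hpos : 0 < 4 * n + 4 + r := by omega
      refine Nat.eq_of_mul_eq_mul_left hpos ?_
      zify at *
      linear_combination (4 * n + 5 + r : ℤ) * (ihr + h1) - 4 * h2

lemma quaternaryForests_succ_mul (n r : ℕ) :
    (3 * n + r + 1) * quaternaryForests n (r + 1) = (r + 1) * (4 * n + r).choose n := by
  have h1 := quaternaryForests_mul n (r + 1)
  have h2 := Nat.choose_mul_succ_eq (4 * n + r) n
  rw [show 4 * n + r + 1 - n = 3 * n + r + 1 by omega] at h2
  refine Nat.eq_of_mul_eq_mul_left (show 0 < 4 * n + r + 1 by omega) ?_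
  rw [← add_assoc] at h1
  calc _ = (3 * n + r + 1) * ((4 * n + r + 1) * quaternaryForests n (r + 1)) := by ring
    _ = (r + 1) * ((4 * n + r + 1).choose n * (3 * n + r + 1)) := by rw [h1]; ring
    _ = _ := by rw [← h2]; ring

/-! ### Rainbow triangulations of an interval of vertices -/

/-- The three vertices `a`, `k`, `b` carry all the colours `1, 2, 3`. -/
def Rainbow (col : ℕ → ℕ) (a k b : ℕ) : Prop :=
  ∀ c, 1 ≤ c → c ≤ 3 → col a = c ∨ col k = c ∨ col b = c

/-- `E` is the set of sides and diagonals of a proper triangulation of the convex polygon with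
vertices `i, i + 1, …, j`. Each of them is encoded as the pair of its end points in increasing
order. Instead of regions, the definition speaks of the triangle below each `ab ∈ E`; the sides
of the polygon need not be mentioned, as they are reached by descending through these triangles. -/
structure IsRainbowTriangulation (col : ℕ → ℕ) (i j : ℕ) (E : Set (ℕ × ℕ)) : Prop where
  bound : ∀ a b, (a, b) ∈ E → i ≤ a ∧ a < b ∧ b ≤ j
  root : (i, j) ∈ E
  noncrossing : ∀ a b c d, a < b → b < c → c < d → (a, c) ∈ E → (b, d) ∉ E
  apex : ∀ a b, (a, b) ∈ E → a + 1 < b →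
    ∃ k, a < k ∧ k < b ∧ (a, k) ∈ E ∧ (k, b) ∈ E ∧ Rainbow col a k b

/-- The number of proper triangulations of the convex polygon with vertices `i, …, j`. -/
noncomputable def rainbowCount (col : ℕ → ℕ) (i j : ℕ) : ℕ :=
  Nat.card {E : Set (ℕ × ℕ) // IsRainbowTriangulation col i j E}

lemma finite_isRainbowTriangulation (col : ℕ → ℕ) (i j : ℕ) :
    Finite {E : Set (ℕ × ℕ) // IsRainbowTriangulation col i j E} := by
  refine Set.Finite.subset ((Set.finite_Iic (j, j)).finite_subsets) fun E hE => ?_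
  rintro ⟨a, b⟩ hab
  have := hE.bound a b hab
  exact ⟨by simp; omega, by simp; omega⟩

lemma rainbowCount_succ (col : ℕ → ℕ) (i : ℕ) : rainbowCount col i (i + 1) = 1 := by
  rw [rainbowCount, Nat.card_eq_one_iff_unique]
  refine ⟨⟨?_⟩, ⟨{(i, i + 1)}, ?_⟩⟩
  · have key : ∀ E, IsRainbowTriangulation col i (i + 1) E → E = {(i, i + 1)} := by
      intro E hE
      ext ⟨a, b⟩
      simp only [Set.mem_singleton_iff, Prod.mk.injEq]
      constructor
      · intro h
        have := hE.bound a b h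
        omega
      · rintro ⟨rfl, rfl⟩
        exact hE.root
    rintro ⟨E, hE⟩ ⟨F, hF⟩
    exact Subtype.ext ((key E hE).trans (key F hF).symm)
  · constructor <;> simp only [Set.mem_singleton_iff, Prod.mk.injEq] <;> omega

/-- The part of a set of segments that lies within `i, …, j`. -/
def restrict (E : Set (ℕ × ℕ)) (i j : ℕ) : Set (ℕ × ℕ) := {e ∈ E | i ≤ e.1 ∧ e.2 ≤ j}

lemma mem_restrict {E : Set (ℕ × ℕ)} {i j a b : ℕ} :
    (a, b) ∈ restrict E i j ↔ (a, b) ∈ E ∧ i ≤ a ∧ b ≤ j := Iff.rfl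

lemma IsRainbowTriangulation.restrict {col : ℕ → ℕ} {i j a b : ℕ} {E : Set (ℕ × ℕ)}
    (hE : IsRainbowTriangulation col i j E) (hab : (a, b) ∈ E) :
    IsRainbowTriangulation col a b (restrict E a b) where
  bound x y h := ⟨h.2.1, (hE.bound x y h.1).2.1, h.2.2⟩
  root := ⟨hab, le_rfl, le_rfl⟩
  noncrossing x y z w hxy hyz hzw h h' := hE.noncrossing x y z w hxy hyz hzw h.1 h'.1
  apex x y h hxy := by
    rw [mem_restrict] at h
    obtain ⟨k, h1, h2, h3, h4, h5⟩ := hE.apex x y h.1 hxy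
    exact ⟨k, h1, h2, ⟨h3, h.2.1, by simp; omega⟩, ⟨h4, by simp; omega, h.2.2⟩, h5⟩

/-- All the sides of the polygon belong to a triangulation. -/
lemma IsRainbowTriangulation.side_mem {col : ℕ → ℕ} {i j : ℕ} {E : Set (ℕ × ℕ)}
    (hE : IsRainbowTriangulation col i j E) {a : ℕ} (hi : i ≤ a) (hj : a < j) :
    (a, a + 1) ∈ E := by
  -- The shortest segment over the side is the side itself.
  have key : ∀ d x y, y - x ≤ d → (x, y) ∈ E → x ≤ a → a < y → (a, a + 1) ∈ E := by
    intro d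
    induction d with
    | zero => intro x y; omega
    | succ d ih =>
      intro x y hd hxy hx hy
      by_cases hs : x + 1 < y
      · obtain ⟨k, h1, h2, h3, h4, -⟩ := hE.apex x y hxy hs
        rcases lt_or_ge a k with h | h
        · exact ih x k (by omega) h3 hx h
        · exact ih k y (by omega) h4 h hy
      · obtain ⟨rfl, rfl⟩ : x = a ∧ y = a + 1 := by omega
        exact hxy
  exact key _ i j le_rfl hE.root hi hj

/-- Two triangulations on the two sides of the apex `k` are glued along the root triangle. -/
def glue (i j : ℕ) (E F : Set (ℕ × ℕ)) : Set (ℕ × ℕ) := insert (i, j) (E ∪ F)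

lemma mem_glue {i j a b : ℕ} {E F : Set (ℕ × ℕ)} :
    (a, b) ∈ glue i j E F ↔ (a = i ∧ b = j) ∨ (a, b) ∈ E ∨ (a, b) ∈ F := by
  simp [glue]

section Glue

variable {col : ℕ → ℕ} {i j k : ℕ} {E F : Set (ℕ × ℕ)}

lemma isRainbowTriangulation_glue (hik : i < k) (hkj : k < j) (hr : Rainbow col i k j)
    (hE : IsRainbowTriangulation col i k E) (hF : IsRainbowTriangulation col k j F) :
    IsRainbowTriangulation col i j (glue i j E F) where
  bound a b h := by
    rcases mem_glue.1 h with h | h | h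
    · omega
    · have := hE.bound a b h; omega
    · have := hF.bound a b h; omega
  root := mem_glue.2 (Or.inl ⟨rfl, rfl⟩)
  noncrossing a b c d hab hbc hcd h h' := by
    rcases mem_glue.1 h with h | h | h <;> rcases mem_glue.1 h' with h' | h' | h'
    · omega
    · have := hE.bound b d h'; omega
    · have := hF.bound b d h'; omega
    · have := hE.bound a c h; omega
    · exact hE.noncrossing a b c d hab hbc hcd h h'
    · have := hE.bound a c h; have := hF.bound b d h'; omega
    · have := hF.bound a c h; omega
    · have := hF.bound a c h; have := hE.bound b d h'; omega
    · exact hF.noncrossing a b c d hab hbc hcd h h'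
  apex a b h hab := by
    rcases mem_glue.1 h with ⟨rfl, rfl⟩ | h | h
    · exact ⟨k, hik, hkj, mem_glue.2 (Or.inr (Or.inl hE.root)),
        mem_glue.2 (Or.inr (Or.inr hF.root)), hr⟩
    · obtain ⟨l, h1, h2, h3, h4, h5⟩ := hE.apex a b h hab
      exact ⟨l, h1, h2, mem_glue.2 (Or.inr (Or.inl h3)), mem_glue.2 (Or.inr (Or.inl h4)), h5⟩
    · obtain ⟨l, h1, h2, h3, h4, h5⟩ := hF.apex a b h hab
      exact ⟨l, h1, h2, mem_glue.2 (Or.inr (Or.inr h3)), mem_glue.2 (Or.inr (Or.inr h4)), h5⟩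

lemma restrict_glue_left (hkj : k < j)
    (hE : IsRainbowTriangulation col i k E) (hF : IsRainbowTriangulation col k j F) :
    restrict (glue i j E F) i k = E := by
  ext ⟨a, b⟩
  rw [mem_restrict, mem_glue]
  constructor
  · rintro ⟨h | h | h, h'⟩
    · omega
    · exact h
    · have := hF.bound a b h; omega
  · intro h
    have := hE.bound a b h
    exact ⟨Or.inr (Or.inl h), by omega, by omega⟩

lemma restrict_glue_right (hik : i < k)
    (hE : IsRainbowTriangulation col i k E) (hF : IsRainbowTriangulation col k j F) :
    restrict (glue i j E F) k j = F := by
  ext ⟨a, b⟩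
  rw [mem_restrict, mem_glue]
  constructor
  · rintro ⟨h | h | h, h'⟩
    · omega
    · have := hE.bound a b h; omega
    · exact h
  · intro h
    have := hF.bound a b h
    exact ⟨Or.inr (Or.inr h), by omega, by omega⟩

/-- A segment over the apex `k` other than the root `ij` would cross `ik` or `kj`. -/
lemma glue_restrict (hik : i < k) (hkj : k < j) (hE : IsRainbowTriangulation col i j E)
    (h1 : (i, k) ∈ E) (h2 : (k, j) ∈ E) : glue i j (restrict E i k) (restrict E k j) = E := by
  ext ⟨a, b⟩
  rw [mem_glue, mem_restrict, mem_restrict]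
  constructor
  · rintro (⟨rfl, rfl⟩ | h | h)
    · exact hE.root
    · exact h.1
    · exact h.1
  · intro h
    have hb := hE.bound a b h
    by_contra hc
    have h3 : a < k ∧ k < b ∧ (i < a ∨ b < j) := by
      simp only [h, true_and] at hc
      omega
    obtain ⟨h3, h4, h5⟩ := h3
    rcases h5 with h5 | h5
    · exact hE.noncrossing i a k b h5 h3 h4 h1 h
    · exact hE.noncrossing a k b j h3 h4 h5 h h2

/-- Two different apices `k < l` are impossible, since `il` would cross `kj`. -/
lemma IsRainbowTriangulation.apex_unique {l : ℕ} (hE : IsRainbowTriangulation col i j E)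
    (h1 : (i, k) ∈ E) (h2 : (k, j) ∈ E) (h3 : (i, l) ∈ E) (h4 : (l, j) ∈ E) : k = l := by
  have b1 := hE.bound _ _ h1
  have b2 := hE.bound _ _ h2
  have b3 := hE.bound _ _ h3
  have b4 := hE.bound _ _ h4
  rcases lt_trichotomy k l with h | h | h
  · exact absurd h2 (hE.noncrossing i k l j (by omega) h (by omega) h3)
  · exact h
  · exact absurd h4 (hE.noncrossing i l k j (by omega) h (by omega) h1)

end Glue

open Classical in
/-- Removing the triangle at the root edge leaves two independent smaller triangulations. -/
lemma rainbowCount_eq_sum (col : ℕ → ℕ) {i j : ℕ} (hij : i + 1 < j) :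
    rainbowCount col i j = ∑ k ∈ (Finset.Ioo i j).filter (fun k => Rainbow col i k j),
      rainbowCount col i k * rainbowCount col k j := by
  have := finite_isRainbowTriangulation col
  set s := (Finset.Ioo i j).filter (fun k => Rainbow col i k j) with hs
  have hmem : ∀ k : s, i < k.1 ∧ k.1 < j ∧ Rainbow col i k j := by
    intro k
    have hk := Finset.mem_filter.1 k.2
    exact ⟨(Finset.mem_Ioo.1 hk.1).1, (Finset.mem_Ioo.1 hk.1).2, hk.2⟩
  let f : (Σ k : s, {E // IsRainbowTriangulation col i k E} ×
      {E // IsRainbowTriangulation col k j E}) → {E // IsRainbowTriangulation col i j E} :=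
    fun x => ⟨glue i j x.2.1.1 x.2.2.1, isRainbowTriangulation_glue (hmem x.1).1 (hmem x.1).2.1
      (hmem x.1).2.2 x.2.1.2 x.2.2.2⟩
  have hf : f.Bijective := by
    constructor
    · rintro ⟨k, ⟨E, hE⟩, ⟨F, hF⟩⟩ ⟨l, ⟨E', hE'⟩, ⟨F', hF'⟩⟩ heq
      have h : glue i j E F = glue i j E' F' := congrArg Subtype.val heq
      obtain rfl : k = l := by
        have hG := isRainbowTriangulation_glue (hmem k).1 (hmem k).2.1 (hmem k).2.2 hE hF
        refine Subtype.ext (hG.apex_unique (mem_glue.2 (Or.inr (Or.inl hE.root)))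
          (mem_glue.2 (Or.inr (Or.inr hF.root))) ?_ ?_) <;> rw [h]
        exacts [mem_glue.2 (Or.inr (Or.inl hE'.root)), mem_glue.2 (Or.inr (Or.inr hF'.root))]
      obtain rfl : E = E' := by
        rw [← restrict_glue_left (hmem k).2.1 hE hF, h,
          restrict_glue_left (hmem k).2.1 hE' hF']
      obtain rfl : F = F' := by
        rw [← restrict_glue_right (hmem k).1 hE hF, h,
          restrict_glue_right (hmem k).1 hE' hF']
      rfl
    · rintro ⟨E, hE⟩
      obtain ⟨k, h1, h2, h3, h4, h5⟩ := hE.apex i j hE.root hij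
      have hk : k ∈ s := by
        rw [hs, Finset.mem_filter, Finset.mem_Ioo]
        exact ⟨⟨h1, h2⟩, h5⟩
      exact ⟨⟨⟨k, hk⟩, ⟨restrict E i k, hE.restrict h3⟩, ⟨restrict E k j, hE.restrict h4⟩⟩,
        Subtype.ext (glue_restrict h1 h2 hE h3 h4)⟩
  rw [rainbowCount, ← Nat.card_eq_of_bijective f hf, Nat.card_sigma]
  simp only [Nat.card_prod]
  exact Finset.sum_coe_sort s fun k => rainbowCount col i k * rainbowCount col k j

/-! ### Counting for the periodic colouring -/

/-- The recursion at the root edge when the colours of `i` and `j` force the residue modulo `3`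
of the apex. -/
lemma rainbowCount_eq_sum_antidiagonal (col : ℕ → ℕ) (i n r s : ℕ) (hr : 1 ≤ r) (hr' : r ≤ 3)
    (hs : 1 ≤ s) (hs' : s ≤ 3)
    (h : ∀ k, i < k → k < i + (3 * n + r + s) →
      (Rainbow col i k (i + (3 * n + r + s)) ↔ k % 3 = (i + r) % 3)) :
    rainbowCount col i (i + (3 * n + r + s)) =
      ∑ p ∈ Finset.HasAntidiagonal.antidiagonal n, rainbowCount col i (i + (3 * p.1 + r)) *
        rainbowCount col (i + (3 * p.1 + r)) (i + (3 * p.1 + r) + (3 * p.2 + s)) := by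
  classical
  rw [rainbowCount_eq_sum col (by omega)]
  symm
  refine Finset.sum_bij (fun p _ => i + (3 * p.1 + r)) ?_ ?_ ?_ ?_
  · rintro ⟨p, q⟩ hp
    rw [Finset.HasAntidiagonal.mem_antidiagonal] at hp
    simp only at hp ⊢
    rw [Finset.mem_filter, Finset.mem_Ioo, h _ (by omega) (by omega)]
    omega
  · rintro ⟨p, q⟩ hp ⟨p', q'⟩ hp' heq
    rw [Finset.HasAntidiagonal.mem_antidiagonal] at hp hp'
    simp only [Prod.mk.injEq] at *
    omega
  · intro k hk
    rw [Finset.mem_filter, Finset.mem_Ioo] at hk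
    have hm := (h k hk.1.1 hk.1.2).1 hk.2
    refine ⟨((k - i - r) / 3, n - (k - i - r) / 3), ?_, ?_⟩
    · rw [Finset.HasAntidiagonal.mem_antidiagonal]
      simp only
      omega
    · simp only
      omega
  · rintro ⟨p, q⟩ hp
    rw [Finset.HasAntidiagonal.mem_antidiagonal] at hp
    simp only at hp ⊢
    rw [show i + (3 * p + r) + (3 * q + s) = i + (3 * n + r + s) by omega]

lemma rainbow_iff {col : ℕ → ℕ} {a k b x y z : ℕ} (ha : col a = x % 3 + 1)
    (hk : col k = y % 3 + 1) (hb : col b = z % 3 + 1) :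
    Rainbow col a k b ↔ x % 3 ≠ y % 3 ∧ y % 3 ≠ z % 3 ∧ x % 3 ≠ z % 3 := by
  rw [Rainbow, ha, hk, hb]
  constructor
  · intro h
    have h1 := h 1 (by omega) (by omega)
    have h2 := h 2 (by omega) (by omega)
    have h3 := h 3 (by omega) (by omega)
    omega
  · intro h c h1 h2
    omega

/-- With the colours `1, 2, 3` periodic, the series for the lengths `3 n + 1` and `3 n + 2` satisfy
`U = 1 + x * V ^ 2` and `V = U ^ 2`. -/
lemma rainbowCount_periodic (col : ℕ → ℕ) (d i : ℕ)
    (hcol : ∀ v, i ≤ v → v ≤ i + d → col v = v % 3 + 1) (n : ℕ) :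
    (d = 3 * n + 1 → rainbowCount col i (i + d) = quaternaryForests n 1) ∧
      (d = 3 * n + 2 → rainbowCount col i (i + d) = quaternaryForests n 2) := by
  induction d using Nat.strong_induction_on generalizing i n with
  | _ d ih =>
  constructor
  · intro hd
    rcases n with _ | n
    · rw [hd, quaternaryForests_zero]
      exact rainbowCount_succ col i
    · obtain rfl : d = 3 * n + 2 + 2 := by omega
      rw [rainbowCount_eq_sum_antidiagonal col i n 2 2 (by omega) (by omega) (by omega) (by omega),
        quaternaryForests_succ_succ, quaternaryForests_succ_zero, zero_add,
        show 0 + 4 = 2 + 2 from rfl, ← sum_antidiagonal_quaternaryForests]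
      · refine Finset.sum_congr rfl fun p hp => ?_
        rw [Finset.HasAntidiagonal.mem_antidiagonal] at hp
        rw [(ih (3 * p.1 + 2) (by omega) i (fun v h1 h2 => hcol v h1 (by omega)) p.1).2 rfl,
          (ih (3 * p.2 + 2) (by omega) _ (fun v h1 h2 => hcol v (by omega) (by omega)) p.2).2 rfl]
      · intro k h1 h2
        rw [rainbow_iff (hcol i (by omega) (by omega)) (hcol k (by omega) (by omega))
          (hcol _ (by omega) le_rfl)]
        omega
  · intro hd
    obtain rfl : d = 3 * n + 1 + 1 := by omega
    rw [rainbowCount_eq_sum_antidiagonal col i n 1 1 (by omega) (by omega) (by omega) (by omega),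
      show 2 = 1 + 1 from rfl, ← sum_antidiagonal_quaternaryForests]
    · refine Finset.sum_congr rfl fun p hp => ?_
      rw [Finset.HasAntidiagonal.mem_antidiagonal] at hp
      rw [(ih (3 * p.1 + 1) (by omega) i (fun v h1 h2 => hcol v h1 (by omega)) p.1).1 rfl,
        (ih (3 * p.2 + 1) (by omega) _ (fun v h1 h2 => hcol v (by omega) (by omega)) p.2).1 rfl]
    · intro k h1 h2
      rw [rainbow_iff (hcol i (by omega) (by omega)) (hcol k (by omega) (by omega))
        (hcol _ (by omega) le_rfl)]
      omega

/-- When the colour of the last vertex is advanced by one, the series for the lengths `3 n + 1` and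
`3 n + 3` satisfy `U = 1 + x * A * V` and `V = A ^ 2 * U`, which is solved by `U = A` and
`V = A ^ 3`. -/
lemma rainbowCount_periodic_shifted_last (col : ℕ → ℕ) (d i : ℕ)
    (hcol : ∀ v, i ≤ v → v < i + d → col v = v % 3 + 1)
    (hlast : col (i + d) = (i + d + 1) % 3 + 1) (n : ℕ) :
    (d = 3 * n + 1 → rainbowCount col i (i + d) = quaternaryForests n 1) ∧
      (d = 3 * n + 3 → rainbowCount col i (i + d) = quaternaryForests n 3) := by
  induction d using Nat.strong_induction_on generalizing i n with
  | _ d ih =>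
  constructor
  · intro hd
    rcases n with _ | n
    · rw [hd, quaternaryForests_zero]
      exact rainbowCount_succ col i
    · obtain rfl : d = 3 * n + 1 + 3 := by omega
      rw [rainbowCount_eq_sum_antidiagonal col i n 1 3 (by omega) (by omega) (by omega) (by omega),
        quaternaryForests_succ_succ, quaternaryForests_succ_zero, zero_add,
        show 0 + 4 = 1 + 3 from rfl, ← sum_antidiagonal_quaternaryForests]
      · refine Finset.sum_congr rfl fun p hp => ?_
        rw [Finset.HasAntidiagonal.mem_antidiagonal] at hp
        have hend : i + (3 * p.1 + 1) + (3 * p.2 + 3) = i + (3 * n + 1 + 3) := by omega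
        rw [(rainbowCount_periodic col (3 * p.1 + 1) i
            (fun v h1 h2 => hcol v h1 (by omega)) p.1).1 rfl,
          (ih (3 * p.2 + 3) (by omega) _ (fun v h1 h2 => hcol v (by omega) (by omega))
            (by rw [hend, hlast]) p.2).2 rfl]
      · intro k h1 h2
        rw [rainbow_iff (hcol i (by omega) (by omega)) (hcol k (by omega) (by omega)) hlast]
        omega
  · intro hd
    obtain rfl : d = 3 * n + 2 + 1 := by omega
    rw [rainbowCount_eq_sum_antidiagonal col i n 2 1 (by omega) (by omega) (by omega) (by omega),
      show 3 = 2 + 1 from rfl, ← sum_antidiagonal_quaternaryForests]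
    · refine Finset.sum_congr rfl fun p hp => ?_
      rw [Finset.HasAntidiagonal.mem_antidiagonal] at hp
      have hend : i + (3 * p.1 + 2) + (3 * p.2 + 1) = i + (3 * n + 2 + 1) := by omega
      rw [(rainbowCount_periodic col (3 * p.1 + 2) i
          (fun v h1 h2 => hcol v h1 (by omega)) p.1).2 rfl,
        (ih (3 * p.2 + 1) (by omega) _ (fun v h1 h2 => hcol v (by omega) (by omega))
          (by rw [hend, hlast]) p.2).1 rfl]
    · intro k h1 h2
      rw [rainbow_iff (hcol i (by omega) (by omega)) (hcol k (by omega) (by omega)) hlast]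
      omega

/-! ### Regions and triangles of a graph on the vertices of the polygon -/

/-- Every triangle of `G` is a region, as any two of its three vertices are neighbours. -/
lemma isRegion_triangle {m : ℕ} {G : SimpleGraph (Fin m)} {a k b : Fin m} (hak : a < k)
    (hkb : k < b) (h1 : G.Adj a k) (h2 : G.Adj k b) (h3 : G.Adj a b) :
    IsRegion G {a, k, b} := by
  refine ⟨?_, ?_⟩
  · rw [Finset.card_eq_three.2 ⟨a, k, b, hak.ne, (hak.trans hkb).ne, hkb.ne, rfl⟩]
  · intro x hx y hy hxy
    simp only [Finset.mem_insert, Finset.mem_singleton] at hx hy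
    have hab := hak.trans hkb
    rcases hx with rfl | rfl | rfl <;> rcases hy with rfl | rfl | rfl
    all_goals first
      | exact absurd hxy (lt_irrefl _)
      | exact absurd hxy (lt_asymm ‹_›)
      | (simp only [*, true_iff, Consecutive, Finset.mem_insert, Finset.mem_singleton,
          forall_eq_or_imp, forall_eq, lt_irrefl, and_false, not_false_eq_true,
          le_refl, true_and, and_true]
         grind)

/-- In a triangulation each edge `ab` that is not a side has a triangle below it. It is found as
the shortest path from `a` to `b` with at least two steps and with increasing vertices: such a
path has no shortcuts, hence its vertices span a region. -/
lemma IsTriangulation.exists_apex {m : ℕ} {G : SimpleGraph (Fin m)} (hG : IsTriangulation G)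
    (hside : ∀ u v : Fin m, (u : ℕ) + 1 = v → G.Adj u v) {a b : Fin m} (hab : G.Adj a b)
    (h : (a : ℕ) + 1 < b) : ∃ k, a < k ∧ k < b ∧ G.Adj a k ∧ G.Adj k b := by
  classical
  have hlt : a < b := by rw [Fin.lt_def]; omega
  let P : Finset (Fin m) → Prop := fun S => a ∈ S ∧ b ∈ S ∧ (∀ v ∈ S, a ≤ v ∧ v ≤ b) ∧
    (∃ v ∈ S, a < v ∧ v < b) ∧
    ∀ u ∈ S, ∀ v ∈ S, u < v → (∀ w ∈ S, ¬(u < w ∧ w < v)) → G.Adj u v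
  have hex : (Finset.univ.filter P).Nonempty := by
    refine ⟨Finset.Icc a b, Finset.mem_filter.2 ⟨Finset.mem_univ _, ?_⟩⟩
    refine ⟨by simp [hlt.le], by simp [hlt.le], fun v hv => Finset.mem_Icc.1 hv, ?_, ?_⟩
    · refine ⟨⟨a + 1, by omega⟩, ?_⟩
      simp only [Finset.mem_Icc, Fin.le_def, Fin.lt_def]
      omega
    · intro u hu v hv huv hw
      refine hside u v ?_
      by_contra hne
      rw [Finset.mem_Icc, Fin.le_def, Fin.le_def] at hu hv
      rw [Fin.lt_def] at huv
      refine hw ⟨u + 1, by omega⟩ ?_ ?_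
      · simp only [Finset.mem_Icc, Fin.le_def]
        omega
      · simp only [Fin.lt_def]
        omega
  obtain ⟨S, hS, hmin⟩ := Finset.exists_min_image _ Finset.card hex
  obtain ⟨-, haS, hbS, hbd, ⟨w, hwS, haw, hwb⟩, hadj⟩ := Finset.mem_filter.1 hS
  have hreg : IsRegion G S := by
    refine ⟨?_, ?_⟩
    · rw [← Finset.card_eq_three.2 ⟨a, w, b, haw.ne, hlt.ne, hwb.ne, rfl⟩]
      refine Finset.card_le_card ?_
      intro x hx
      simp only [Finset.mem_insert, Finset.mem_singleton] at hx
      rcases hx with rfl | rfl | rfl <;> assumption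
    · intro x hx y hy hxy
      constructor
      · intro hadjxy
        by_contra hc
        simp only [Consecutive, not_or, not_forall, not_not] at hc
        obtain ⟨⟨s, hs, hxs, hsy⟩, ⟨t, ht, hty⟩⟩ := hc
        -- The edge `xy` is a shortcut: it replaces the vertices strictly between `x` and `y`.
        have hlt' : (S.filter fun v => ¬(x < v ∧ v < y)).card < S.card :=
          Finset.card_lt_card (Finset.filter_ssubset.2 ⟨s, hs, fun hn => hn ⟨hxs, hsy⟩⟩)
        refine absurd (hmin _ (Finset.mem_filter.2 ⟨Finset.mem_univ _, ?_⟩)) (not_le.2 hlt')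
        have hxb := hbd x hx
        have hyb := hbd y hy
        have htb := hbd t ht
        simp only [P, Finset.mem_filter]
        refine ⟨⟨haS, by grind⟩, ⟨hbS, by grind⟩, fun v hv => hbd v hv.1, ?_, ?_⟩
        · by_cases hax : a < x
          · exact ⟨x, ⟨hx, by simp⟩, hax, lt_of_lt_of_le hxy hyb.2⟩
          · refine ⟨y, ⟨hy, by simp⟩, by order, ?_⟩
            by_contra hyb'
            exact hty ⟨by order, by order⟩
        · intro u hu v hv huv hbetween
          by_cases hz : ∃ z ∈ S, u < z ∧ z < v
          · obtain ⟨z, hz, huz, hzv⟩ := hz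
            have hzxy : x < z ∧ z < y := by
              by_contra hn
              exact hbetween z ⟨hz, hn⟩ ⟨huz, hzv⟩
            have h1 := hbetween x ⟨hx, by simp⟩
            have h2 := hbetween y ⟨hy, by simp⟩
            obtain rfl : u = x := by grind
            obtain rfl : v = y := by grind
            exact hadjxy
          · exact hadj u hu.1 v hv.1 huv (by push Not at hz; grind)
      · rintro (hc | hc)
        · exact hadj x hx y hy hxy hc
        · obtain rfl : a = x := le_antisymm (hbd x hx).1 (hc a haS).1
          obtain rfl : b = y := le_antisymm (hc b hbS).2 (hbd y hy).2
          exact hab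
  have hcard := hG.2 S hreg
  have hSeq : ({a, w, b} : Finset (Fin m)) = S := by
    refine Finset.eq_of_subset_of_card_le ?_ ?_
    · intro x hx
      simp only [Finset.mem_insert, Finset.mem_singleton] at hx
      rcases hx with rfl | rfl | rfl <;> assumption
    · rw [hcard, Finset.card_eq_three.2 ⟨a, w, b, haw.ne, hlt.ne, hwb.ne, rfl⟩]
  refine ⟨w, haw, hwb, hadj a haS w hwS haw ?_, hadj w hwS b hbS hwb ?_⟩
  all_goals
    rw [← hSeq]
    grind

/-- If every edge other than a side has a triangle below it, then each region is the triangle below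
its longest edge: the apex `k` of that triangle is a vertex of the region, since an edge of the
region over `k` would cross a side of the triangle. -/
lemma IsRegion.eq_triangle {m : ℕ} {G : SimpleGraph (Fin m)}
    (hcross : ∀ a b c d : Fin m, a < b → b < c → c < d → ¬(G.Adj a c ∧ G.Adj b d))
    {Q : Fin m → Fin m → Fin m → Prop}
    (hapex : ∀ a b : Fin m, G.Adj a b → (a : ℕ) + 1 < b →
      ∃ k, a < k ∧ k < b ∧ G.Adj a k ∧ G.Adj k b ∧ Q a k b)
    {S : Finset (Fin m)} (hS : IsRegion G S) :
    ∃ a k b, a < k ∧ k < b ∧ Q a k b ∧ S = {a, k, b} := by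
  classical
  obtain ⟨hcard, hadj⟩ := hS
  have hne : S.Nonempty := Finset.card_pos.1 (by omega)
  set a := S.min' hne with ha
  set b := S.max' hne with hb
  have haS : a ∈ S := S.min'_mem hne
  have hbS : b ∈ S := S.max'_mem hne
  have hbd : ∀ v ∈ S, a ≤ v ∧ v ≤ b := fun v hv => ⟨S.min'_le v hv, S.le_max' v hv⟩
  obtain ⟨w, hwS, hwa, hwb⟩ : ∃ w ∈ S, w ≠ a ∧ w ≠ b := by
    by_contra hc
    push Not at hc
    have : S ⊆ {a, b} := by
      intro x hx
      have := hc x hx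
      simp only [Finset.mem_insert, Finset.mem_singleton]
      tauto
    have := (Finset.card_le_card this).trans Finset.card_le_two
    omega
  have haw : a < w := lt_of_le_of_ne (hbd w hwS).1 hwa.symm
  have hwb : w < b := lt_of_le_of_ne (hbd w hwS).2 hwb
  have hlt := haw.trans hwb
  obtain ⟨k, hak, hkb, h1, h2, hQ⟩ :=
    hapex a b ((hadj a haS b hbS hlt).2 (Or.inr hbd)) (by rw [Fin.lt_def] at haw hwb; omega)
  have hkS : k ∈ S := by
    by_contra hk
    obtain ⟨u, hu, humax⟩ := (S.filter (· < k)).exists_max_image id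
      ⟨a, Finset.mem_filter.2 ⟨haS, hak⟩⟩
    obtain ⟨v, hv, hvmin⟩ := (S.filter (k < ·)).exists_min_image id
      ⟨b, Finset.mem_filter.2 ⟨hbS, hkb⟩⟩
    rw [Finset.mem_filter] at hu hv
    simp only [Finset.mem_filter, id, and_imp] at humax hvmin
    have huv : ∀ x ∈ S, ¬(u < x ∧ x < v) := by
      rintro x hx ⟨hux, hxv⟩
      rcases lt_trichotomy x k with h | rfl | h
      · exact absurd (humax x hx h) (not_le.2 hux)
      · exact hk hx
      · exact absurd (hvmin x hx h) (not_le.2 hxv)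
    have huvadj := (hadj u hu.1 v hv.1 (hu.2.trans hv.2)).2 (Or.inl huv)
    rcases (hbd u hu.1).1.lt_or_eq with h | h
    · exact hcross a u k v h hu.2 hv.2 ⟨h1, huvadj⟩
    · rcases (hbd v hv.1).2.lt_or_eq with h' | h'
      · exact hcross u k v b hu.2 hv.2 h' ⟨huvadj, h2⟩
      · exact huv w hwS ⟨h ▸ haw, h' ▸ hwb⟩
  refine ⟨a, k, b, hak, hkb, hQ, ?_⟩
  have c1 := (hadj a haS k hkS hak).1 h1
  have c2 := (hadj k hkS b hbS hkb).1 h2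
  ext x
  simp only [Finset.mem_insert, Finset.mem_singleton]
  constructor
  · intro hx
    have hxb := hbd x hx
    have d1 : ¬(a < x ∧ x < k) := by
      rcases c1 with c | c
      · exact c x hx
      · exact absurd (c b hbS).2 (not_le.2 hkb)
    have d2 : ¬(k < x ∧ x < b) := by
      rcases c2 with c | c
      · exact c x hx
      · exact absurd (c a haS).1 (not_le.2 hak)
    grind
  · rintro (rfl | rfl | rfl) <;> assumption

/-! ### From graphs to sets of segments -/

/-- The edges of a graph on `Fin m`, encoded as the increasing pairs of their end points. -/
def segments {m : ℕ} (G : SimpleGraph (Fin m)) : Set (ℕ × ℕ) :=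
  {e | ∃ u v : Fin m, u < v ∧ G.Adj u v ∧ e = (↑u, ↑v)}

lemma mem_segments {m : ℕ} {G : SimpleGraph (Fin m)} {u v : Fin m} :
    ((u : ℕ), (v : ℕ)) ∈ segments G ↔ u < v ∧ G.Adj u v := by
  constructor
  · rintro ⟨x, y, h1, h2, h3⟩
    rw [Prod.mk.injEq, Fin.val_inj, Fin.val_inj] at h3
    obtain ⟨rfl, rfl⟩ := h3
    exact ⟨h1, h2⟩
  · rintro ⟨h1, h2⟩
    exact ⟨u, v, h1, h2, rfl⟩

lemma segments_injective (m : ℕ) : (segments (m := m)).Injective := by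
  intro G H h
  have key : ∀ u v : Fin m, u < v → (G.Adj u v ↔ H.Adj u v) := by
    intro u v huv
    have h1 := mem_segments (G := G) (u := u) (v := v)
    rw [h, mem_segments] at h1
    tauto
  ext u v
  rcases lt_trichotomy u v with h | rfl | h
  · exact key u v h
  · simp
  · rw [G.adj_comm, H.adj_comm]
    exact key v u h

/-- The graph on `Fin m` with a given set of segments as edges. -/
def graphOfSegments (m : ℕ) (E : Set (ℕ × ℕ)) : SimpleGraph (Fin m) where
  Adj u v := (u < v ∧ ((u : ℕ), (v : ℕ)) ∈ E) ∨ (v < u ∧ ((v : ℕ), (u : ℕ)) ∈ E)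
  symm := ⟨fun _ _ h => h.symm⟩
  loopless := ⟨fun u h => by simp at h⟩

lemma graphOfSegments_adj {m : ℕ} {E : Set (ℕ × ℕ)} {u v : Fin m} (h : u < v) :
    (graphOfSegments m E).Adj u v ↔ ((u : ℕ), (v : ℕ)) ∈ E := by
  simp [graphOfSegments, h, h.not_gt]

lemma cycleGraph_adj_of_succ {N : ℕ} {u v : Fin (N + 2)} (h : (u : ℕ) + 1 = v) :
    (SimpleGraph.cycleGraph (N + 2)).Adj u v := by
  rw [SimpleGraph.cycleGraph_adj, sub_eq_iff_eq_add, sub_eq_iff_eq_add]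
  refine Or.inr (Fin.ext ?_)
  rw [add_comm 1 u, Fin.val_add_one_of_lt (Fin.lt_def.2 (by rw [Fin.val_last]; omega)), h]

lemma cycleGraph_adj_zero_last (N : ℕ) :
    (SimpleGraph.cycleGraph (N + 2)).Adj 0 (Fin.last (N + 1)) := by
  rw [SimpleGraph.cycleGraph_adj, sub_eq_iff_eq_add, sub_eq_iff_eq_add]
  exact Or.inl (by rw [add_comm 1 (Fin.last _), Fin.last_add_one])

lemma cycleGraph_adj_lt {N : ℕ} {u v : Fin (N + 2)} (huv : u < v)
    (h : (SimpleGraph.cycleGraph (N + 2)).Adj u v) :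
    (u : ℕ) + 1 = v ∨ (u = 0 ∧ v = Fin.last (N + 1)) := by
  rw [SimpleGraph.cycleGraph_adj, sub_eq_iff_eq_add, sub_eq_iff_eq_add] at h
  rcases h with h | h
  · right
    have hv : v = Fin.last (N + 1) := by
      by_contra hne
      have h' := Fin.val_add_one_of_lt (lt_of_le_of_ne (Fin.le_last v) hne)
      rw [add_comm v 1, ← h] at h'
      rw [Fin.lt_def] at huv
      omega
    refine ⟨?_, hv⟩
    rw [h, hv, add_comm 1 (Fin.last _), Fin.last_add_one]
  · left
    rw [h, add_comm 1 u,
      Fin.val_add_one_of_lt (lt_of_lt_of_le huv (Fin.le_last v))]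

/-- The colouring `color3`, extended to all natural numbers. -/
def color3Nat (m v : ℕ) : ℕ := if m % 3 = 1 ∧ v + 1 = m then 2 else v % 3 + 1

lemma isRainbowTriangulation_segments {N : ℕ} {G : SimpleGraph (Fin (N + 2))}
    (hT : IsTriangulation G) (hP : IsProper 3 (color3 (N + 2)) G) :
    IsRainbowTriangulation (color3Nat (N + 2)) 0 (N + 1) (segments G) where
  bound := by
    rintro _ _ ⟨u, v, h1, -, h3⟩
    rw [Prod.mk.injEq] at h3
    obtain ⟨rfl, rfl⟩ := h3
    exact ⟨Nat.zero_le _, h1, by omega⟩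
  root := ⟨0, Fin.last (N + 1), Fin.last_pos, hT.1.1 (cycleGraph_adj_zero_last N), by simp⟩
  noncrossing := by
    rintro _ _ _ _ hab hbc hcd ⟨a, c, -, h1, h1'⟩ ⟨b, d, -, h2, h2'⟩
    rw [Prod.mk.injEq] at h1' h2'
    obtain ⟨rfl, rfl⟩ := h1'
    obtain ⟨rfl, rfl⟩ := h2'
    exact hT.1.2 a b c d hab hbc hcd ⟨h1, h2⟩
  apex := by
    rintro _ _ ⟨a, b, -, h1, h1'⟩ hab
    rw [Prod.mk.injEq] at h1'
    obtain ⟨rfl, rfl⟩ := h1'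
    obtain ⟨k, hak, hkb, h2, h3⟩ := hT.exists_apex
      (fun u v h => hT.1.1 (cycleGraph_adj_of_succ h)) h1 hab
    refine ⟨k, hak, hkb, mem_segments.2 ⟨hak, h2⟩, mem_segments.2 ⟨hkb, h3⟩, ?_⟩
    intro c hc hc'
    obtain ⟨v, hv, hvc⟩ := hP _ (isRegion_triangle hak hkb h2 h3 h1) c hc hc'
    simp only [Finset.mem_insert, Finset.mem_singleton] at hv
    rcases hv with rfl | rfl | rfl
    exacts [Or.inl hvc, Or.inr (Or.inl hvc), Or.inr (Or.inr hvc)]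

lemma graphOfSegments_spec {N : ℕ} {E : Set (ℕ × ℕ)}
    (hE : IsRainbowTriangulation (color3Nat (N + 2)) 0 (N + 1) E) :
    IsTriangulation (graphOfSegments (N + 2) E) ∧
      IsProper 3 (color3 (N + 2)) (graphOfSegments (N + 2) E) := by
  have hcross : ∀ a b c d : Fin (N + 2), a < b → b < c → c < d →
      ¬((graphOfSegments (N + 2) E).Adj a c ∧ (graphOfSegments (N + 2) E).Adj b d) := by
    intro a b c d hab hbc hcd
    rw [graphOfSegments_adj (hab.trans hbc), graphOfSegments_adj (hbc.trans hcd)]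
    exact fun h => hE.noncrossing a b c d hab hbc hcd h.1 h.2
  have hregion : ∀ S, IsRegion (graphOfSegments (N + 2) E) S → ∃ a k b : Fin (N + 2), a < k ∧
      k < b ∧ Rainbow (color3Nat (N + 2)) a k b ∧ S = {a, k, b} := by
    intro S hS
    refine hS.eq_triangle (Q := fun a k b => Rainbow (color3Nat (N + 2)) a k b) hcross ?_
    intro a b h hab
    rw [graphOfSegments_adj (by rw [Fin.lt_def]; omega)] at h
    obtain ⟨k, h1, h2, h3, h4, h5⟩ := hE.apex a b h hab
    have hk : k < N + 2 := by omega
    refine ⟨⟨k, hk⟩, h1, h2, ?_, ?_, h5⟩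
    · exact (graphOfSegments_adj (v := ⟨k, hk⟩) h1).2 h3
    · exact (graphOfSegments_adj (u := ⟨k, hk⟩) h2).2 h4
  refine ⟨⟨⟨?_, hcross⟩, ?_⟩, ?_⟩
  · have key : ∀ u v : Fin (N + 2), u < v → (SimpleGraph.cycleGraph (N + 2)).Adj u v →
        (graphOfSegments (N + 2) E).Adj u v := by
      intro u v huv h
      rw [graphOfSegments_adj huv]
      rcases cycleGraph_adj_lt huv h with h | ⟨rfl, rfl⟩
      · rw [← h]
        exact hE.side_mem (Nat.zero_le _) (by omega)
      · simpa using hE.root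
    intro u v h
    rcases lt_or_gt_of_ne h.ne with huv | huv
    · exact key u v huv h
    · exact (key v u huv h.symm).symm
  · intro S hS
    obtain ⟨a, k, b, hak, hkb, -, rfl⟩ := hregion S hS
    exact Finset.card_eq_three.2 ⟨a, k, b, hak.ne, (hak.trans hkb).ne, hkb.ne, rfl⟩
  · intro S hS c hc hc'
    obtain ⟨a, k, b, hak, hkb, hr, rfl⟩ := hregion S hS
    rcases hr c hc hc' with h | h | h
    · exact ⟨a, by simp, h⟩
    · exact ⟨k, by simp, h⟩
    · exact ⟨b, by simp, h⟩

lemma segments_graphOfSegments {N : ℕ} {E : Set (ℕ × ℕ)} {col : ℕ → ℕ}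
    (hE : IsRainbowTriangulation col 0 (N + 1) E) : segments (graphOfSegments (N + 2) E) = E := by
  ext ⟨a, b⟩
  constructor
  · rintro ⟨u, v, h1, h2, h3⟩
    rw [h3]
    exact (graphOfSegments_adj h1).1 h2
  · intro h
    have hb := hE.bound a b h
    have hlt : (⟨a, by omega⟩ : Fin (N + 2)) < ⟨b, by omega⟩ := hb.2.1
    exact ⟨_, _, hlt, (graphOfSegments_adj hlt).2 h, rfl⟩

lemma b_eq_rainbowCount (N : ℕ) : b N = rainbowCount (color3Nat (N + 2)) 0 (N + 1) := by
  rw [b, ← Nat.card_coe_set_eq, rainbowCount]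
  refine Nat.card_eq_of_bijective
    (fun G => ⟨segments G.1, isRainbowTriangulation_segments G.2.1 G.2.2⟩) ⟨?_, ?_⟩
  · intro G H h
    exact Subtype.ext (segments_injective _ (congrArg Subtype.val h))
  · rintro ⟨E, hE⟩
    exact ⟨⟨graphOfSegments (N + 2) E, graphOfSegments_spec hE⟩,
      Subtype.ext (segments_graphOfSegments hE)⟩

/-! ### The three residue classes -/

lemma b_three_mul (n : ℕ) : b (3 * n) = quaternaryForests n 1 := by
  rw [b_eq_rainbowCount, ← zero_add (3 * n + 1)]
  refine (rainbowCount_periodic _ (3 * n + 1) 0 (fun v _ _ => ?_) n).1 rfl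
  rw [color3Nat, if_neg (by omega)]

lemma b_three_mul_add_one (n : ℕ) : b (3 * n + 1) = quaternaryForests n 2 := by
  rw [b_eq_rainbowCount, ← zero_add (3 * n + 1 + 1)]
  refine (rainbowCount_periodic _ (3 * n + 1 + 1) 0 (fun v _ _ => ?_) n).2 rfl
  rw [color3Nat, if_neg (by omega)]

lemma b_three_mul_add_two (n : ℕ) : b (3 * n + 2) = quaternaryForests n 3 := by
  rw [b_eq_rainbowCount, ← zero_add (3 * n + 2 + 1)]
  refine (rainbowCount_periodic_shifted_last _ (3 * n + 2 + 1) 0 (fun v _ _ => ?_) ?_ n).2 rfl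
  · rw [color3Nat, if_neg (by omega)]
  · rw [color3Nat, if_pos (by omega)]
    omega

lemma quaternaryForests_succ_eq_div (n r : ℕ) : (quaternaryForests n (r + 1) : ℚ) =
    (r + 1) / (3 * n + r + 1) * ((4 * n + r).choose n : ℚ) := by
  have h : ((3 * n + r + 1 : ℕ) : ℚ) ≠ 0 := by positivity
  have h' := congrArg (Nat.cast : ℕ → ℚ) (quaternaryForests_succ_mul n r)
  push_cast at h h'
  rw [div_mul_eq_mul_div, eq_div_iff h, mul_comm, h']

end ConvexPolygon

open ConvexPolygon in
theorem theorem2p2 (n : ℕ) :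
    (ConvexPolygon.b (3 * n) : ℚ) = 1 / (3 * n + 1) * (Nat.choose (4 * n) n : ℚ) ∧
    (ConvexPolygon.b (3 * n + 1) : ℚ) = 2 / (3 * n + 2) * (Nat.choose (4 * n + 1) n : ℚ) ∧
    (ConvexPolygon.b (3 * n + 2) : ℚ) = 3 / (3 * n + 3) * (Nat.choose (4 * n + 2) n : ℚ) := by
  rw [b_three_mul, b_three_mul_add_one, b_three_mul_add_two]
  refine ⟨?_, ?_, ?_⟩
  · simpa using quaternaryForests_succ_eq_div n 0
  · rw [quaternaryForests_succ_eq_div n 1]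
    push_cast
    ring
  · rw [quaternaryForests_succ_eq_div n 2]
    push_cast
    ring
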